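/- Let $k,n$ be integers with $n\ge 2k\ge 1$, let $V$ be a set with $|V|=n$, and let $V^{(k)}$ be the collection of $k$-element subsets of $V$. For weightings $w,u\in\mathbb R^{V^{(k)}}$ write $\langle w,u\rangle=\sum_{e\in V^{(k)}}w(e)u(e)$ and $d(w)=\binom nk^{-1}\sum_{e\in V^{(k)}}w(e)$; for a permutation $\pi$ of $V$ put $w_\pi(e)=w(\pi^{-1}e)$; and let $$\operatorname{disc}(w,u)=\max_{\pi}\Bigl|\langle w_\pi,u\rangle-d(w)d(u)\tbinom nk\Bigr|,$$ the maximum being over all permutations $\pi$ of $V$. The $W$-vector $(W_0,\dots,W_k)$ of $w$ is defined recursively: $W_0=|d(w)|$ and, for $1\le i\le k$, $$W_i=\frac1{n(n-1)}\sum_{x\ne y}W^{xy}_{i-1},$$ where the sum is over ordered pairs of distinct $x,y\in V$ and $(W^{xy}_0,\dots,W^{xy}_{k-1})$ is the $W$-vector of the weighting $w^{xy}(e)=w(e\cup\{x\})-w(e\cup\{y\})$ of the $(k-1)$-subsets $e$ of $V\setminus\{x,y\}$. Fix distinct vertices $x_1,y_1,\dots,x_k,y_k\in V$. For $0\le i\le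 k$ and $A\in V^{(k)}$ let $\phi_i(A)=(-1)^{|A\cap\{y_1,\dots,y_i\}|}$ if $|A\cap\{x_j,y_j\}|=1$ for all $1\le j\le i$, and $\phi_i(A)=0$ otherwise. Let $V_i\subseteq\mathbb R^{V^{(k)}}$ be the linear span of the weightings $(\phi_i)_\pi$, over all permutations $\pi$ of $V$. Then: (a) For $1\le i\le k$ and every $w\in\mathbb R^{V^{(k)}}$, $\operatorname{disc}(w,\phi_i)=0$ if and only if $w\in V_i^\perp$. (b) If $u\in V_i$ and $w\in V_j$, where $0\le i,j\le k$ and $i\ne j$, then $\operatorname{disc}(u,w)=0$. (c) $\mathbb R^{V^{(k)}}$ is the direct sum $V_0\oplus\cdots\oplus V_k$. (d) If $u=u_0+\cdots+u_k$ with $u_i\in V_i$ for each $i$, and $(U_0,\dots,U_k)$ is the $W$-vector of $u$, then for each $0\le i\le k$ we have $U_i=0$ if and only if $u_i=0$. (e) If $t\ge1$ and $w_1,\dots,w_t\in\mathbb R^{V^{(k)}}$ are nonzero with $\operatorname{disc}(w_i,w_j)=0$ for all $i\ne j$, then there are pairwise disjoint (possibly empty) sets $I_1,\dots,I_t$ with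 $I_1\cup\cdots\cup I_t=\{1,\dots,k\}$ such that $$w_i\in V_0\oplus\bigoplus_{h\in I_i}V_h\qquad\text{for each }1\le i\le t.$$ -/

import Mathlib

namespace WHyp

noncomputable section

universe u

/-- The space `ℝ^{V^{(k)}}` of weighted `k`-uniform hypergraphs `w : V^{(k)} → ℝ`, with its standard
inner product `⟨w, u⟩ = ∑ e, w e * u e`. -/
abbrev Weighting (V : Type u) [Fintype V] (k : ℕ) : Type u :=
  EuclideanSpace ℝ (Set.powersetCard V k)

/-- The weighted hypergraph `w_π`, given by `w_π(e) = w(π⁻¹ e)`. -/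
def permute {V : Type u} [Fintype V] {k : ℕ} (π : Equiv.Perm V) (w : Weighting V k) :
    Weighting V k :=
  WithLp.toLp 2 fun e => w (Set.powersetCard.map k (π⁻¹ : Equiv.Perm V).toEmbedding e)

/-- The density `d(w) = w(V) / C(n, k)`, where `w(V)` is the sum of all weights. -/
def density {V : Type u} [Fintype V] {k : ℕ} (w : Weighting V k) : ℝ :=
  (∑ e, w e) / ((Fintype.card V).choose k : ℝ)

/-- The discrepancy of a pair: `disc(w, u) = max_π |⟨w_π, u⟩ - d(w) d(u) C(n, k)|`. -/
def disc {V : Type u} [Fintype V] [DecidableEq V] {k : ℕ} (w u : Weighting V k) : ℝ :=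
  Finset.univ.sup' Finset.univ_nonempty fun π : Equiv.Perm V =>
    |inner ℝ (permute π w) u - density w * density u * ((Fintype.card V).choose k : ℝ)|

/-- For `e ⊆ V ∖ {x, y}` of size `k` and `z ∈ {x, y}`, the edge `e ∪ {z}` of size `k + 1`. -/
def addVertex {V : Type u} [DecidableEq V] {k : ℕ} {x y : V}
    (e : Set.powersetCard {v : V // v ≠ x ∧ v ≠ y} k) (z : V) (hz : z = x ∨ z = y) :
    Set.powersetCard V (k + 1) :=
  ⟨insert z (e.1.map (Function.Embedding.subtype _)), by
    have hnot : z ∉ e.1.map (Function.Embedding.subtype _) := by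
      intro h
      obtain ⟨a, -, ha⟩ := Finset.mem_map.1 h
      have ha' : a.1 = z := ha
      rcases hz with hz | hz
      · exact a.2.1 (ha'.trans hz)
      · exact a.2.2 (ha'.trans hz)
    change Finset.card _ = k + 1
    rw [Finset.card_insert_of_notMem hnot, Finset.card_map]
    exact congrArg (· + 1) e.2⟩

/-- The difference weighting `w^{xy}` on the `k`-subsets of `V ∖ {x, y}`, given by
`w^{xy}(e) = w(e ∪ {x}) - w(e ∪ {y})`. -/
def diffWeighting {V : Type u} [Fintype V] [DecidableEq V] {k : ℕ} (w : Weighting V (k + 1))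
    (x y : V) : Weighting {v : V // v ≠ x ∧ v ≠ y} k :=
  WithLp.toLp 2 fun e => w (addVertex e x (Or.inl rfl)) - w (addVertex e y (Or.inr rfl))

/-- The entry `W_i` of the `W`-vector `(W_0, …, W_k)` of `w`: `W_0 = |d(w)|`, and `W_{i+1}` is the
average of the entries `W_i^{xy}` of the `W`-vectors of the difference weightings `w^{xy}`, over all
ordered pairs of distinct vertices `x, y`. (Only `i ≤ k` is meaningful; other entries are `0`.) -/
def wVector : (i : ℕ) → {k : ℕ} → {V : Type u} → [Fintype V] → [DecidableEq V] →
    Weighting V k → ℝ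
  | 0, _, _, _, _, w => |density w|
  | _ + 1, 0, _, _, _, _ => 0
  | i + 1, _ + 1, V, _, _, w =>
      (∑ x : V, ∑ y : V, if x ≠ y then wVector i (diffWeighting w x y) else 0) /
        ((Fintype.card V : ℝ) * ((Fintype.card V : ℝ) - 1))

/-- The canonical weighting `φ_i` of a sequence `x_1, y_1, …, x_k, y_k` (indexed from `0` here, so
that `x_1, y_1, …, x_i, y_i` are the `x j, y j` with `j < i`): if `A` meets each of the pairs
`{x_j, y_j}`, `j ≤ i`, in exactly one vertex then `φ_i(A) = (-1)^{|A ∩ {y_1, …, y_i}|}`, and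
otherwise `φ_i(A) = 0`. -/
def phi {V : Type u} [Fintype V] [DecidableEq V] {k : ℕ} (x y : Fin k → V) (i : Fin (k + 1)) :
    Weighting V k :=
  WithLp.toLp 2 fun A =>
    if ∀ j : Fin k, (j : ℕ) < (i : ℕ) → (A.1 ∩ {x j, y j}).card = 1 then
      (-1 : ℝ) ^ (A.1 ∩ (Finset.univ.filter fun j : Fin k => (j : ℕ) < (i : ℕ)).image y).card
    else 0

/-- The subspace `V_i` spanned by all the permuted weightings `(φ_i)_π`. -/
def canonicalSpan {V : Type u} [Fintype V] [DecidableEq V] {k : ℕ} (x y : Fin k → V)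
    (i : Fin (k + 1)) : Submodule ℝ (Weighting V k) :=
  Submodule.span ℝ (Set.range fun π : Equiv.Perm V => permute π (phi x y i))

end

end WHyp

/-! The weighting φ_i is the product over l ≤ i of 1[x_l ∈ A] - 1[y_l ∈ A]. Permutations carry any i
disjoint pairs to any others, so V_i is the span of all such products over i disjoint pairs.

Orthogonality: a product of fewer factors expands into monomials. Each monomial has too few vertices
to touch every pair of a longer product; swapping an untouched pair fixes the monomial and negates
the product (`inner_pairWeighting_eq_zero`). Hence the V_i are mutually orthogonal, and for i ≥ 1
they have density 0, so discrepancies involving them are maxima of inner products. This gives (a)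
and (b).

W-vector: peeling off one pair turns an inner product with w into one with w^{xy}. By induction W_i
= 0 iff w ⊥ V_i (`wVector_eq_zero_iff`). If all W_i vanish, all w^{xy} vanish by induction on k, so
w is constant of density 0, hence 0 (`eq_zero_of_wVector_eq_zero`). So the V_i span, which gives (c)
and (d).

For (e), a weighting with the sign symmetries of a product is a multiple of it
(`mul_pairWeighting_comm`). Projecting the product onto an invariant subspace keeps those
symmetries, so the subspace contains the product or is orthogonal to it. Apply this to the span of
the permutations of w - d(w), which is orthogonal to u when disc(w, u) = 0: the weightings w and u
cannot both have components in the same V_i, i ≥ 1. -/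

namespace WHyp

noncomputable section

open Finset

universe u

/-! ### The action of vertex permutations on weightings -/

section Permute

variable {V : Type*} [Fintype V] {k : ℕ}

theorem permute_apply (π : Equiv.Perm V) (w : Weighting V k) (A : Set.powersetCard V k) :
    permute π w A = w (Set.powersetCard.map k (π⁻¹ : Equiv.Perm V).toEmbedding A) := rfl

theorem permute_sub (π : Equiv.Perm V) (w u : Weighting V k) :
    permute π (w - u) = permute π w - permute π u := rfl

theorem edgeMap_mul {V : Type*} (π σ : Equiv.Perm V) (A : Set.powersetCard V k) :
    Set.powersetCard.map k (π * σ).toEmbedding A =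
      Set.powersetCard.map k π.toEmbedding (Set.powersetCard.map k σ.toEmbedding A) := by
  apply Subtype.ext
  simp only [Set.powersetCard.val_map, Finset.map_map]
  rfl

theorem edgeMap_one {V : Type*} (A : Set.powersetCard V k) :
    Set.powersetCard.map k (1 : Equiv.Perm V).toEmbedding A = A := by
  apply Subtype.ext
  exact Finset.map_refl

theorem permute_mul (π σ : Equiv.Perm V) (w : Weighting V k) :
    permute (π * σ) w = permute π (permute σ w) := by
  ext A
  simp only [permute_apply, mul_inv_rev, edgeMap_mul]

theorem permute_one (w : Weighting V k) : permute 1 w = w := by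
  ext A
  simp only [permute_apply, inv_one, edgeMap_one]

theorem inner_eq_sum (w u : Weighting V k) : inner ℝ w u = ∑ A, w A * u A := by
  simp [PiLp.inner_apply, mul_comm]

/-- The action of a permutation of the vertices on the edges. -/
def edgePerm (k : ℕ) (π : Equiv.Perm V) : Equiv.Perm (Set.powersetCard V k) where
  toFun := Set.powersetCard.map k π.toEmbedding
  invFun := Set.powersetCard.map k (π⁻¹ : Equiv.Perm V).toEmbedding
  left_inv A := by rw [← edgeMap_mul, inv_mul_cancel, edgeMap_one]
  right_inv A := by rw [← edgeMap_mul, mul_inv_cancel, edgeMap_one]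

theorem inner_permute_permute (π : Equiv.Perm V) (w u : Weighting V k) :
    inner ℝ (permute π w) (permute π u) = inner ℝ w u := by
  rw [inner_eq_sum, inner_eq_sum]
  exact Equiv.sum_comp (edgePerm k π⁻¹) fun A => w A * u A

theorem inner_permute_left (π : Equiv.Perm V) (w u : Weighting V k) :
    inner ℝ (permute π w) u = inner ℝ w (permute π⁻¹ u) := by
  rw [← inner_permute_permute π w, ← permute_mul, mul_inv_cancel, permute_one]

theorem mem_map_inv_iff {V : Type*} (π : Equiv.Perm V) (A : Set.powersetCard V k) (v : V) :
    v ∈ (Set.powersetCard.map k (π⁻¹ : Equiv.Perm V).toEmbedding A).1 ↔ π v ∈ A.1 := by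
  rw [Set.powersetCard.val_map, Finset.mem_map]
  constructor
  · rintro ⟨a, ha, rfl⟩
    simpa using ha
  · intro h
    exact ⟨π v, h, by simp⟩

end Permute

/-! ### Products of pair differences and their orthogonality -/

section PairWeighting

variable {V : Type*} [Fintype V] [DecidableEq V] {ι : Type*} [Fintype ι]

/-- The product over `l` of `1[x l ∈ A] - 1[y l ∈ A]`. -/
def signProd {V : Type*} [DecidableEq V] (x y : ι → V) (A : Finset V) : ℝ :=
  ∏ l, ((if x l ∈ A then 1 else 0) - (if y l ∈ A then 1 else 0))

/-- The weighting `A ↦ ∏ l, (1[x l ∈ A] - 1[y l ∈ A])` of the `k`-subsets. -/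
def pairWeighting (k : ℕ) (x y : ι → V) : Weighting V k :=
  WithLp.toLp 2 fun A => signProd x y A.1

theorem pairWeighting_apply {k : ℕ} (x y : ι → V) (A : Set.powersetCard V k) :
    pairWeighting k x y A = signProd x y A.1 := rfl

theorem permute_pairWeighting {k : ℕ} (π : Equiv.Perm V) (x y : ι → V) :
    permute π (pairWeighting k x y) = pairWeighting k (π ∘ x) (π ∘ y) := by
  ext A
  simp only [permute_apply, pairWeighting_apply, signProd, mem_map_inv_iff, Function.comp_apply]

theorem signProd_eq_zero {V : Type*} [DecidableEq V] {x y : ι → V} {A : Finset V} (l : ι)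
    (h : x l ∈ A ↔ y l ∈ A) :
    signProd x y A = 0 :=
  Finset.prod_eq_zero (Finset.mem_univ l) (by simp [h])

theorem permute_swap_pair {k : ℕ} {x y : ι → V} (h : Function.Injective (Sum.elim x y)) (l : ι) :
    permute (Equiv.swap (x l) (y l)) (pairWeighting k x y) = -pairWeighting k x y := by
  classical
  rw [permute_pairWeighting]
  ext A
  change signProd _ _ _ = - signProd _ _ _
  have hx : ∀ m, m ≠ l → x m ≠ x l := fun m hm e =>
    hm (Sum.inl_injective (h (a₁ := Sum.inl m) (a₂ := Sum.inl l) e))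
  have hy : ∀ m, m ≠ l → y m ≠ y l := fun m hm e =>
    hm (Sum.inr_injective (h (a₁ := Sum.inr m) (a₂ := Sum.inr l) e))
  have hn : ∀ m m', x m ≠ y m' := fun m m' e => by
    simpa using h (a₁ := Sum.inl m) (a₂ := Sum.inr m') e
  unfold signProd
  rw [← Finset.mul_prod_erase _ _ (Finset.mem_univ l),
    ← Finset.mul_prod_erase _ (fun l => ((if x l ∈ A.1 then (1 : ℝ) else 0) -
      (if y l ∈ A.1 then 1 else 0))) (Finset.mem_univ l), ← neg_mul]
  congr 1
  · simp
  · refine Finset.prod_congr rfl fun m hm => ?_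
    have hm := Finset.ne_of_mem_erase hm
    simp only [Function.comp_apply, Equiv.swap_apply_of_ne_of_ne (hx m hm) (hn m l),
      Equiv.swap_apply_of_ne_of_ne (hn l m).symm (hy m hm)]

theorem permute_swap_of_notMem {k : ℕ} {x y : ι → V} {a b : V} (hxa : ∀ l, x l ≠ a)
    (hya : ∀ l, y l ≠ a) (hxb : ∀ l, x l ≠ b) (hyb : ∀ l, y l ≠ b) :
    permute (Equiv.swap a b) (pairWeighting k x y) = pairWeighting k x y := by
  rw [permute_pairWeighting]
  congr 1 <;> ext l
  · exact Equiv.swap_apply_of_ne_of_ne (hxa l) (hxb l)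
  · exact Equiv.swap_apply_of_ne_of_ne (hya l) (hyb l)

/-- A product of pair differences is orthogonal to every longer product over disjoint pairs. -/
theorem inner_pairWeighting_eq_zero {κ : Type*} [Fintype κ] {k : ℕ} (x' y' : κ → V) {x y : ι → V}
    (h : Function.Injective (Sum.elim x y)) (hlt : Fintype.card κ < Fintype.card ι) :
    inner ℝ (pairWeighting k x' y') (pairWeighting k x y) = 0 := by
  classical
  -- The monomials of the shorter product: `t` records the factors from which `x'` is taken.
  let F : Finset κ → Weighting V k := fun t => WithLp.toLp 2 fun A =>
    (∏ l ∈ t, if x' l ∈ A.1 then (1 : ℝ) else 0) * ∏ l ∈ univ \ t, if y' l ∈ A.1 then (1 : ℝ) else 0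
  have hF : pairWeighting k x' y' = ∑ t ∈ univ.powerset, (-1 : ℝ) ^ (univ \ t).card • F t := by
    ext A
    rw [pairWeighting_apply, signProd]
    simp only [sub_eq_add_neg]
    rw [Finset.prod_add]
    simp only [WithLp.ofLp_sum, Finset.sum_apply, PiLp.smul_apply, smul_eq_mul, F]
    refine Finset.sum_congr rfl fun t _ => ?_
    rw [Finset.prod_neg]
    ring
  rw [hF, sum_inner]
  refine Finset.sum_eq_zero fun t _ => ?_
  rw [real_inner_smul_left]
  refine mul_eq_zero_of_right _ ?_
  let z : κ → V := fun l => if l ∈ t then x' l else y' l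
  -- Pigeonhole: a vertex lies in at most one of the disjoint pairs, so fewer vertices than pairs
  -- miss some pair.
  obtain ⟨l, hl⟩ : ∃ l : ι, ∀ m, z m ≠ x l ∧ z m ≠ y l := by
    by_contra! hc
    have hc' : ∀ l, ∃ m, z m = x l ∨ z m = y l := fun l => by
      obtain ⟨m, hm⟩ := hc l
      exact ⟨m, or_iff_not_imp_left.2 hm⟩
    choose f hf using hc'
    refine absurd (Fintype.card_le_of_injective f fun a b hab => ?_) (not_le.2 hlt)
    have ha := hf a
    have hb := hf b
    rw [hab] at ha
    rcases ha with ha | ha <;> rcases hb with hb | hb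
    · exact Sum.inl_injective (h (a₁ := Sum.inl a) (a₂ := Sum.inl b) (ha.symm.trans hb))
    · simpa using h (a₁ := Sum.inl a) (a₂ := Sum.inr b) (ha.symm.trans hb)
    · simpa using h (a₁ := Sum.inr a) (a₂ := Sum.inl b) (ha.symm.trans hb)
    · exact Sum.inr_injective (h (a₁ := Sum.inr a) (a₂ := Sum.inr b) (ha.symm.trans hb))
  have hinv : permute (Equiv.swap (x l) (y l)) (F t) = F t := by
    ext A
    rw [permute_apply]
    simp only [F, mem_map_inv_iff]
    congr 1
    · refine Finset.prod_congr rfl fun m hm => ?_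
      have := hl m
      simp only [z, if_pos hm] at this
      rw [Equiv.swap_apply_of_ne_of_ne this.1 this.2]
    · refine Finset.prod_congr rfl fun m hm => ?_
      have := hl m
      simp only [z, if_neg (Finset.mem_sdiff.1 hm).2] at this
      rw [Equiv.swap_apply_of_ne_of_ne this.1 this.2]
  have := inner_permute_permute (Equiv.swap (x l) (y l)) (F t) (pairWeighting k x y)
  rw [hinv, permute_swap_pair h, inner_neg_right] at this
  linarith

end PairWeighting

/-! ### The canonical weightings as products of pair differences -/

section Phi

variable {V : Type*} [Fintype V] [DecidableEq V] {k : ℕ}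

theorem phi_eq_pairWeighting {x y : Fin k → V} (h : Function.Injective (Sum.elim x y))
    (i : Fin (k + 1)) :
    phi x y i = pairWeighting k (x ∘ Fin.castLE (Nat.lt_succ_iff.1 i.2))
      (y ∘ Fin.castLE (Nat.lt_succ_iff.1 i.2)) := by
  have hn : ∀ m, x m ≠ y m := fun m e => by
    simpa using h (a₁ := Sum.inl m) (a₂ := Sum.inr m) e
  have hy : Function.Injective y := fun a b e =>
    Sum.inr_injective (h (a₁ := Sum.inr a) (a₂ := Sum.inr b) e)
  have hone : ∀ (A : Finset V) (j : Fin k), (A ∩ {x j, y j}).card = 1 ↔ ¬(x j ∈ A ↔ y j ∈ A) := by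
    intro A j
    have := hn j
    by_cases h1 : x j ∈ A <;> by_cases h2 : y j ∈ A <;>
      simp [h1, h2, Finset.inter_insert_of_mem, Finset.inter_insert_of_notMem,
        Finset.inter_singleton_of_mem, Finset.inter_singleton_of_notMem, this]
  ext A
  rw [pairWeighting_apply]
  change (if _ then _ else _) = _
  split_ifs with hA
  · have hprod : signProd (x ∘ Fin.castLE (Nat.lt_succ_iff.1 i.2))
        (y ∘ Fin.castLE (Nat.lt_succ_iff.1 i.2)) A.1 =
        ∏ l : Fin i, if y (Fin.castLE (Nat.lt_succ_iff.1 i.2) l) ∈ A.1 then (-1 : ℝ) else 1 := by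
      refine Finset.prod_congr rfl fun l _ => ?_
      have := (hone A.1 _).1 (hA (Fin.castLE (Nat.lt_succ_iff.1 i.2) l) l.2)
      simp only [Function.comp_apply]
      by_cases h2 : y (Fin.castLE (Nat.lt_succ_iff.1 i.2) l) ∈ A.1 <;> simp_all
    rw [hprod, Finset.prod_ite, Finset.prod_const_one, mul_one, Finset.prod_const]
    congr 1
    symm
    refine Finset.card_bij (fun l _ => y (Fin.castLE (Nat.lt_succ_iff.1 i.2) l)) ?_ ?_ ?_
    · intro l hl
      simp only [Finset.mem_inter, Finset.mem_image, Finset.mem_filter, Finset.mem_univ, true_and]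
      exact ⟨(Finset.mem_filter.1 hl).2, _, l.2, rfl⟩
    · intro a _ b _ e
      exact Fin.castLE_injective _ (hy e)
    · intro b hb
      simp only [Finset.mem_inter, Finset.mem_image, Finset.mem_filter, Finset.mem_univ,
        true_and] at hb
      obtain ⟨hb, j, hj, rfl⟩ := hb
      exact ⟨⟨j, hj⟩, by simpa using hb, rfl⟩
  · push Not at hA
    obtain ⟨j, hj, hj'⟩ := hA
    refine (signProd_eq_zero (⟨j, hj⟩ : Fin i) ?_).symm
    exact not_not.1 fun hc => hj' ((hone A.1 j).2 hc)

theorem injective_elim_castLE {V : Type*} {x y : Fin k → V}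
    (h : Function.Injective (Sum.elim x y)) {i : ℕ} (hi : i ≤ k) : Function.Injective (Sum.elim (x ∘ Fin.castLE hi) (y ∘ Fin.castLE hi)) := by
  have : Sum.elim (x ∘ Fin.castLE hi) (y ∘ Fin.castLE hi) =
      Sum.elim x y ∘ Sum.map (Fin.castLE hi) (Fin.castLE hi) := by
    ext a
    cases a <;> rfl
  rw [this]
  exact h.comp (Sum.map_injective.2 ⟨Fin.castLE_injective hi, Fin.castLE_injective hi⟩)

theorem injective_elim_comp {V ι : Type*} {x y : ι → V} (h : Function.Injective (Sum.elim x y))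
    (π : Equiv.Perm V) : Function.Injective (Sum.elim (π ∘ x) (π ∘ y)) := by
  rw [← Sum.comp_elim]
  exact π.injective.comp h

theorem exists_perm_comp_eq {V ι : Type*} [Finite ι] {x y x' y' : ι → V}
    (h : Function.Injective (Sum.elim x y)) (h' : Function.Injective (Sum.elim x' y')) :
    ∃ π : Equiv.Perm V, π ∘ x = x' ∧ π ∘ y = y' := by
  obtain ⟨π, hπ⟩ := Equiv.Perm.exists_extending_pair (Sum.elim x y) (Sum.elim x' y') h h'
  exact ⟨π, funext fun l => hπ (Sum.inl l), funext fun l => hπ (Sum.inr l)⟩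

/-- Permutations act transitively on sequences of `i` disjoint pairs, so the orbit of `φ_i` consists
of all products over such sequences, whatever pairs were fixed at the start. -/
theorem mem_canonicalSpan_orthogonal_iff {x y : Fin k → V} (h : Function.Injective (Sum.elim x y))
    (i : Fin (k + 1)) (w : Weighting V k) :
    w ∈ (canonicalSpan x y i)ᗮ ↔ ∀ x' y' : Fin i → V, Function.Injective (Sum.elim x' y') →
      inner ℝ (pairWeighting k x' y') w = 0 := by
  have hi := Nat.lt_succ_iff.1 i.2
  rw [canonicalSpan, Submodule.mem_orthogonal]
  constructor
  · intro hw x' y' h'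
    obtain ⟨π, rfl, rfl⟩ := exists_perm_comp_eq (injective_elim_castLE h hi) h'
    rw [← permute_pairWeighting, ← phi_eq_pairWeighting h]
    exact hw _ (Submodule.subset_span ⟨π, rfl⟩)
  · intro hw u hu
    induction hu using Submodule.span_induction with
    | mem u hu =>
      obtain ⟨π, rfl⟩ := hu
      simp only
      rw [phi_eq_pairWeighting h, permute_pairWeighting]
      exact hw _ _ (injective_elim_comp (injective_elim_castLE h hi) π)
    | zero => exact inner_zero_left _
    | add u v _ _ hu hv => rw [inner_add_left, hu, hv, add_zero]
    | smul c u _ hu => rw [inner_smul_left, hu, mul_zero]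

end Phi

/-! ### Proportionality by exchanging vertices -/

section Exchange

variable {V : Type*} [DecidableEq V] {k : ℕ}

/-- Two functions on the `k`-subsets are proportional as soon as any two distinct sets can be brought
closer by an exchange that multiplies both functions by the same factor. -/
theorem mul_comm_of_exchange (f g : Set.powersetCard V k → ℝ)
    (h : ∀ A B : Set.powersetCard V k, A ≠ B → f A * g B = f B * g A ∨
      ∃ a ∈ A.1 \ B.1, ∃ b ∈ B.1 \ A.1, ∃ ε : ℝ, ε ≠ 0 ∧ ∀ A' : Set.powersetCard V k,
        A'.1 = insert b (A.1.erase a) → f A' = ε * f A ∧ g A' = ε * g A)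
    (A B : Set.powersetCard V k) : f A * g B = f B * g A := by
  induction hm : (A.1 \ B.1).card using Nat.strong_induction_on generalizing A with
  | _ m ih =>
    subst hm
    by_cases hAB : A = B
    · rw [hAB]
    rcases h A B hAB with h | ⟨a, ha, b, hb, ε, hε, h⟩
    · exact h
    rw [Finset.mem_sdiff] at ha hb
    have hb' : b ∉ A.1.erase a := fun hc => hb.2 (Finset.mem_of_mem_erase hc)
    let A' : Set.powersetCard V k := Set.powersetCard.ofCard (s := insert b (A.1.erase a)) (by
      rw [Finset.card_insert_of_notMem hb', Finset.card_erase_add_one ha.1, A.2])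
    obtain ⟨hf, hg⟩ := h A' rfl
    -- The exchange removes `a` from the difference, and the new vertex `b` already lies in `B`.
    have hlt : (A'.1 \ B.1).card < (A.1 \ B.1).card := by
      refine Finset.card_lt_card ⟨fun c hc => ?_, fun hc => ?_⟩
      · simp only [A', Set.powersetCard.val_ofCard, Finset.mem_sdiff, Finset.mem_insert,
          Finset.mem_erase] at hc ⊢
        rcases hc with ⟨rfl | hc, hc'⟩
        · exact absurd hb.1 hc'
        · exact ⟨hc.2, hc'⟩
      · have := hc (Finset.mem_sdiff.2 ha)
        simp only [A', Set.powersetCard.val_ofCard, Finset.mem_sdiff, Finset.mem_insert,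
          Finset.mem_erase] at this
        rcases this.1 with rfl | h'
        · exact hb.2 ha.1
        · exact h'.1 rfl
    have := ih _ hlt A' rfl
    rw [hf, hg] at this
    refine mul_left_cancel₀ hε ?_
    linear_combination this

theorem exists_mem_sdiff_of_ne {A B : Set.powersetCard V k} (h : A ≠ B) :
    ∃ a, a ∈ A.1 \ B.1 := by
  obtain ⟨a, ha, hb⟩ := (Set.powersetCard.exists_mem_notMem_iff_ne A B).1 h
  exact ⟨a, Finset.mem_sdiff.2 ⟨ha, hb⟩⟩

end Exchange

/-! ### Edges containing exactly one of two given vertices -/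

section AddVertex

variable {V : Type*} [DecidableEq V] {k : ℕ}

/-- Here `z, z'` stand for `a, b` in either order, so that one statement serves both terms of
`w^{ab}`. -/
theorem exists_addVertex_eq {a b z z' : V} (hz : z = a ∨ z = b)
    (hzz' : ∀ v, v ≠ z → v ≠ z' → v ≠ a ∧ v ≠ b) (A : Set.powersetCard V (k + 1)) (hA : z ∈ A.1)
    (hA' : z' ∉ A.1) :
    ∃ e : Set.powersetCard {v : V // v ≠ a ∧ v ≠ b} k,
      e.1.map (Function.Embedding.subtype _) = A.1.erase z ∧ addVertex e z hz = A := by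
  have hmap : ((A.1.erase z).subtype fun v => v ≠ a ∧ v ≠ b).map (Function.Embedding.subtype _) =
      A.1.erase z := by
    refine Finset.subtype_map_of_mem fun v hv => ?_
    rw [Finset.mem_erase] at hv
    exact hzz' v hv.1 fun h => hA' (h ▸ hv.2)
  refine ⟨Set.powersetCard.ofCard (s := (A.1.erase z).subtype fun v => v ≠ a ∧ v ≠ b) ?_, hmap, ?_⟩
  · rw [← Finset.card_map (Function.Embedding.subtype _), hmap, Finset.card_erase_of_mem hA,
      A.2, Nat.add_sub_cancel]
  · apply Subtype.ext
    change insert z (Finset.map _ _) = _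
    rw [Set.powersetCard.val_ofCard, hmap, Finset.insert_erase hA]

theorem mem_map_subtype_iff {V : Type*} {p : V → Prop} (s : Finset {v // p v}) (v : {v // p v}) :
    v.1 ∈ s.map (Function.Embedding.subtype p) ↔ v ∈ s := by
  simp [v.2]

theorem sum_addVertex [Fintype V] {a b z z' : V} (hz : z = a ∨ z = b)
    (hzz' : ∀ v, v ≠ z → v ≠ z' → v ≠ a ∧ v ≠ b) (hne : z ≠ z') (hz' : z' = a ∨ z' = b)
    (f : Set.powersetCard V (k + 1) → ℝ) :
    ∑ e : Set.powersetCard {v : V // v ≠ a ∧ v ≠ b} k, f (addVertex e z hz) =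
      ∑ A, if z ∈ A.1 ∧ z' ∉ A.1 then f A else 0 := by
  have hnot : ∀ (e : Set.powersetCard {v : V // v ≠ a ∧ v ≠ b} k) (c : V), c = a ∨ c = b →
      c ∉ e.1.map (Function.Embedding.subtype _) := by
    intro e c hc hm
    obtain ⟨d, -, hd⟩ := Finset.mem_map.1 hm
    have hd : d.1 = c := hd
    rcases hc with hc | hc
    · exact d.2.1 (hd.trans hc)
    · exact d.2.2 (hd.trans hc)
  refine Fintype.sum_of_injective (fun e => addVertex e z hz) ?_ _ _ ?_ ?_
  · intro e e' h
    have h : insert z (e.1.map (Function.Embedding.subtype _)) =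
      insert z (e'.1.map (Function.Embedding.subtype _)) := congrArg Subtype.val h
    have := congrArg (Finset.erase · z) h
    simp only [Finset.erase_insert (hnot _ z hz)] at this
    exact Subtype.ext (Finset.map_injective _ this)
  · intro A hA
    rw [if_neg]
    rintro ⟨h1, h2⟩
    obtain ⟨e, -, he⟩ := exists_addVertex_eq hz hzz' A h1 h2
    exact hA ⟨e, he⟩
  · intro e
    rw [if_pos]
    refine ⟨Finset.mem_insert_self _ _, fun hc => ?_⟩
    rcases Finset.mem_insert.1 hc with hc | hc
    · exact hne hc.symm
    · exact hnot e z' hz' hc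

end AddVertex

/-! ### Vanishing of the W-vector -/

section WVector

/-- The factor of the pair `a, b` is 1 on edges containing only `a`, -1 on those containing only
`b`, and 0 elsewhere; the other factors do not see `a` or `b`. -/
theorem inner_pairWeighting_cons {V : Type*} [Fintype V] [DecidableEq V] {k i : ℕ} {a b : V}
    (hab : a ≠ b) (x y : Fin i → {v : V // v ≠ a ∧ v ≠ b}) (w : Weighting V (k + 1)) :
    inner ℝ (pairWeighting (k + 1) (Fin.cons a (Subtype.val ∘ x) : Fin (i + 1) → V)
      (Fin.cons b (Subtype.val ∘ y) : Fin (i + 1) → V)) w =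
      inner ℝ (pairWeighting k x y) (diffWeighting w a b) := by
  rw [inner_eq_sum, inner_eq_sum]
  have hS : ∀ (e : Set.powersetCard {v : V // v ≠ a ∧ v ≠ b} k) (z : V) (hz : z = a ∨ z = b),
      signProd (Subtype.val ∘ x) (Subtype.val ∘ y) (addVertex e z hz).1 = signProd x y e.1 := by
    intro e z hz
    have hmem : ∀ v : {v : V // v ≠ a ∧ v ≠ b}, v.1 ∈ (addVertex e z hz).1 ↔ v ∈ e.1 := by
      intro v
      change v.1 ∈ insert z _ ↔ _
      rw [Finset.mem_insert, mem_map_subtype_iff, or_iff_right]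
      rintro rfl
      exact hz.elim v.2.1 v.2.2
    simp only [signProd, Function.comp_apply, hmem]
  let f : Set.powersetCard V (k + 1) → ℝ := fun A =>
    signProd (Subtype.val ∘ x) (Subtype.val ∘ y) A.1 * w A
  have h1 := sum_addVertex (k := k) (a := a) (b := b) (z := a) (z' := b) (Or.inl rfl)
    (fun v h h' => ⟨h, h'⟩) hab (Or.inr rfl) f
  have h2 := sum_addVertex (k := k) (a := a) (b := b) (z := b) (z' := a) (Or.inr rfl)
    (fun v h h' => ⟨h', h⟩) hab.symm (Or.inl rfl) f
  have hr : ∀ e : Set.powersetCard {v : V // v ≠ a ∧ v ≠ b} k,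
      pairWeighting k x y e * diffWeighting w a b e =
      f (addVertex e a (Or.inl rfl)) - f (addVertex e b (Or.inr rfl)) := by
    intro e
    simp only [f, hS]
    rw [← mul_sub]
    rfl
  simp only [hr]
  rw [Finset.sum_sub_distrib, h1, h2, ← Finset.sum_sub_distrib]
  refine Finset.sum_congr rfl fun A _ => ?_
  rw [pairWeighting_apply]
  have : signProd (Fin.cons a (Subtype.val ∘ x) : Fin (i + 1) → V)
      (Fin.cons b (Subtype.val ∘ y) : Fin (i + 1) → V) A.1 =
      ((if a ∈ A.1 then 1 else 0) - (if b ∈ A.1 then 1 else 0)) *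
        signProd (Subtype.val ∘ x) (Subtype.val ∘ y) A.1 := by
    simp only [signProd, Fin.prod_univ_succ, Fin.cons_zero, Fin.cons_succ]
  rw [this]
  by_cases ha : a ∈ A.1 <;> by_cases hb : b ∈ A.1 <;> simp [ha, hb, f]

/-- Nonnegativity is what lets a vanishing average force every term to vanish. -/
theorem wVector_nonneg (i : ℕ) : ∀ {k : ℕ} {V : Type u} [Fintype V] [DecidableEq V]
    (w : Weighting V k), 0 ≤ wVector i w := by
  induction i with
  | zero =>
    intro k V _ _ w
    rw [wVector]
    exact abs_nonneg _
  | succ i ih =>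
    intro k V _ _ w
    cases k with
    | zero => rw [wVector]
    | succ k =>
      rw [wVector]
      refine div_nonneg (Finset.sum_nonneg fun a _ => Finset.sum_nonneg fun b _ => ?_) ?_
      · split_ifs
        · exact ih _
        · exact le_rfl
      · rcases Nat.eq_zero_or_pos (Fintype.card V) with h | h
        · simp [h]
        · have : (1 : ℝ) ≤ Fintype.card V := by exact_mod_cast h
          exact mul_nonneg (by linarith) (by linarith)

theorem wVector_succ_eq_zero_iff (i : ℕ) {k : ℕ} {V : Type u} [Fintype V] [DecidableEq V]
    (w : Weighting V (k + 1)) :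
    wVector (i + 1) w = 0 ↔ ∀ a b : V, a ≠ b → wVector i (diffWeighting w a b) = 0 := by
  have hnn : ∀ a b : V, 0 ≤ if a ≠ b then wVector i (diffWeighting w a b) else 0 := by
    intro a b
    split_ifs
    · exact wVector_nonneg _ _
    · exact le_rfl
  rw [wVector]
  constructor
  · intro h a b hab
    have hcard : 2 ≤ Fintype.card V := by
      have := Fintype.one_lt_card_iff.2 ⟨a, b, hab⟩
      exact this
    have hcard : (2 : ℝ) ≤ Fintype.card V := by exact_mod_cast hcard
    have hpos : (0 : ℝ) < (Fintype.card V : ℝ) * ((Fintype.card V : ℝ) - 1) :=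
      mul_pos (by linarith) (by linarith)
    have h := (div_eq_zero_iff.1 h).resolve_right hpos.ne'
    rw [Finset.sum_eq_zero_iff_of_nonneg fun a _ => Finset.sum_nonneg fun b _ => hnn a b] at h
    have h := h a (Finset.mem_univ a)
    rw [Finset.sum_eq_zero_iff_of_nonneg fun b _ => hnn a b] at h
    simpa [hab] using h b (Finset.mem_univ b)
  · intro h
    rw [Finset.sum_eq_zero, zero_div]
    intro a _
    refine Finset.sum_eq_zero fun b _ => ?_
    split_ifs with hab
    · exact h a b hab
    · rfl

theorem density_eq_zero_iff {V : Type*} [Fintype V] {k : ℕ} (w : Weighting V k) :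
    density w = 0 ↔ ∑ A, w A = 0 := by
  rw [density, div_eq_zero_iff, or_iff_left_iff_imp]
  -- If the denominator is 0, the density is 0 by convention, but then there are no edges to sum
  -- over.
  intro h
  have h : (Fintype.card V).choose k = 0 := by exact_mod_cast h
  have : IsEmpty (Set.powersetCard V k) := by
    rw [← Finite.card_eq_zero_iff, Set.powersetCard.card, Nat.card_eq_fintype_card, h]
  exact Fintype.sum_empty _

theorem inner_pairWeighting_of_isEmpty {V ι : Type*} [Fintype V] [DecidableEq V] [Fintype ι]
    [IsEmpty ι] {k : ℕ} (x y : ι → V) (w : Weighting V k) :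
    inner ℝ (pairWeighting k x y) w = ∑ A, w A := by
  simp [inner_eq_sum, pairWeighting_apply, signProd]

theorem wVector_eq_zero_iff (i : ℕ) : ∀ {k : ℕ} {V : Type u} [Fintype V] [DecidableEq V]
    (w : Weighting V k), wVector i w = 0 ↔ ∀ x y : Fin i → V,
      Function.Injective (Sum.elim x y) → inner ℝ (pairWeighting k x y) w = 0 := by
  induction i with
  | zero =>
    intro k V _ _ w
    rw [wVector, abs_eq_zero, density_eq_zero_iff]
    simp only [inner_pairWeighting_of_isEmpty]
    exact ⟨fun h _ _ _ => h, fun h => h Fin.elim0 Fin.elim0 (Function.injective_of_subsingleton _)⟩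
  | succ i ih =>
    intro k V _ _ w
    cases k with
    | zero =>
      rw [wVector]
      -- The default value 0 is consistent: a nonempty product vanishes on the empty edge.
      refine iff_of_true rfl fun x y _ => ?_
      rw [inner_eq_sum]
      refine Finset.sum_eq_zero fun A _ => ?_
      have hA : A.1 = ∅ := Finset.card_eq_zero.1 A.2
      rw [pairWeighting_apply, signProd_eq_zero 0 (by simp [hA]), zero_mul]
    | succ k =>
      rw [wVector_succ_eq_zero_iff]
      simp only [ih]
      constructor
      · intro H x y hxy
        have hx : ∀ j : Fin i, x j.succ ≠ x 0 ∧ x j.succ ≠ y 0 := fun j =>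
          ⟨fun e => Fin.succ_ne_zero j
            (Sum.inl_injective (hxy (a₁ := Sum.inl j.succ) (a₂ := Sum.inl 0) e)),
            fun e => by simpa using hxy (a₁ := Sum.inl j.succ) (a₂ := Sum.inr 0) e⟩
        have hy : ∀ j : Fin i, y j.succ ≠ x 0 ∧ y j.succ ≠ y 0 := fun j =>
          ⟨fun e => by simpa using hxy (a₁ := Sum.inr j.succ) (a₂ := Sum.inl 0) e,
            fun e => Fin.succ_ne_zero j
            (Sum.inr_injective (hxy (a₁ := Sum.inr j.succ) (a₂ := Sum.inr 0) e))⟩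
        have h0 : x 0 ≠ y 0 := fun e => by
          simpa using hxy (a₁ := Sum.inl 0) (a₂ := Sum.inr 0) e
        have key := H (x 0) (y 0) h0 (fun j => ⟨x j.succ, hx j⟩) (fun j => ⟨y j.succ, hy j⟩) ?_
        · rw [← inner_pairWeighting_cons h0] at key
          have hcx : (Fin.cons (x 0) (Subtype.val ∘ fun j => (⟨x j.succ, hx j⟩ :
              {v : V // v ≠ x 0 ∧ v ≠ y 0})) : Fin (i + 1) → V) = x := Fin.cons_self_tail x
          have hcy : (Fin.cons (y 0) (Subtype.val ∘ fun j => (⟨y j.succ, hy j⟩ :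
              {v : V // v ≠ x 0 ∧ v ≠ y 0})) : Fin (i + 1) → V) = y := Fin.cons_self_tail y
          rwa [hcx, hcy] at key
        · refine Function.Injective.of_comp (f := Subtype.val) ?_
          have : Subtype.val ∘ Sum.elim (fun j => (⟨x j.succ, hx j⟩ :
              {v : V // v ≠ x 0 ∧ v ≠ y 0})) (fun j => ⟨y j.succ, hy j⟩) =
              Sum.elim x y ∘ Sum.map Fin.succ Fin.succ := by
            ext a
            cases a <;> rfl
          rw [this]
          exact hxy.comp (Sum.map_injective.2 ⟨Fin.succ_injective i, Fin.succ_injective i⟩)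
      · intro H a b hab x y hxy
        rw [← inner_pairWeighting_cons hab]
        apply H
        have hxy' := Subtype.val_injective.comp hxy
        rw [Sum.comp_elim] at hxy'
        rw [Sum.elim_injective] at hxy' ⊢
        simp only [Fin.cons_injective_iff, Set.mem_range, not_exists]
        refine ⟨⟨fun j => (x j).2.1, hxy'.1⟩, ⟨fun j => (y j).2.2, hxy'.2.1⟩, ?_⟩
        intro j m
        refine Fin.cases ?_ (fun j => ?_) j <;> refine Fin.cases ?_ (fun m => ?_) m
        · simpa using hab
        · simpa using (y m).2.1.symm
        · simpa using (x j).2.2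
        · simpa using hxy'.2.2 j m

/-- A weighting whose `W`-vector vanishes is zero. -/
theorem eq_zero_of_wVector_eq_zero (k : ℕ) : ∀ {V : Type u} [Fintype V] [DecidableEq V]
    (_ : 2 * k ≤ Fintype.card V) (w : Weighting V k), (∀ i ≤ k, wVector i w = 0) → w = 0 := by
  induction k with
  | zero =>
    intro V _ _ _ w h
    have h := h 0 le_rfl
    rw [wVector, abs_eq_zero, density_eq_zero_iff] at h
    have hs : Subsingleton (Set.powersetCard V 0) := ⟨fun A B => Subtype.ext <|
      (Finset.card_eq_zero.1 A.2).trans (Finset.card_eq_zero.1 B.2).symm⟩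
    ext A
    rwa [Fintype.sum_subsingleton _ A] at h
  | succ k ih =>
    intro V _ _ hV w h
    have hdiff : ∀ a b : V, a ≠ b → diffWeighting w a b = 0 := by
      intro a b hab
      refine ih ?_ _ fun i hi => (wVector_succ_eq_zero_iff i w).1 (h (i + 1) (by omega)) a b hab
      have hc : Fintype.card {v : V // v ≠ a ∧ v ≠ b} + 2 = Fintype.card V := by
        have h1 := Fintype.card_subtype_compl (fun v : V => v = a ∨ v = b)
        have h2 : Fintype.card {v : V // v = a ∨ v = b} = 2 := by
          rw [Fintype.card_subtype, ← Finset.card_pair hab]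
          congr 1
          ext
          simp
        have h3 : Fintype.card {v : V // v ≠ a ∧ v ≠ b} =
            Fintype.card {v : V // ¬(v = a ∨ v = b)} :=
          Fintype.card_congr (Equiv.subtypeEquivRight fun v => by simp [not_or])
        omega
      omega
    -- Vanishing differences make `w` invariant under single exchanges, hence proportional to the
    -- constant 1.
    have hconst : ∀ A B, w A = w B := by
      intro A B
      have := mul_comm_of_exchange w (fun _ => 1) (fun A B hAB => Or.inr ?_) A B
      · simpa using this
      obtain ⟨a, ha⟩ := exists_mem_sdiff_of_ne hAB
      obtain ⟨b, hb⟩ := exists_mem_sdiff_of_ne hAB.symm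
      refine ⟨a, ha, b, hb, 1, one_ne_zero, fun A' hA' => ⟨?_, by simp⟩⟩
      rw [Finset.mem_sdiff] at ha hb
      have hab : a ≠ b := by
        rintro rfl
        exact ha.2 hb.1
      obtain ⟨e, he, heA⟩ := exists_addVertex_eq (a := a) (b := b) (z := a) (z' := b) (Or.inl rfl)
        (fun v h h' => ⟨h, h'⟩) A ha.1 hb.2
      have heA' : addVertex e b (Or.inr rfl) = A' := Subtype.ext <| by
        rw [hA', ← he]
        rfl
      have h0 : diffWeighting w a b e = 0 := by rw [hdiff a b hab]; rfl
      have h0 : w (addVertex e a (Or.inl rfl)) - w (addVertex e b (Or.inr rfl)) = 0 := h0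
      rw [heA, heA'] at h0
      linarith
    have h := h 0 (Nat.zero_le _)
    rw [wVector, abs_eq_zero, density_eq_zero_iff] at h
    ext A
    rw [Finset.sum_congr rfl fun B _ => hconst B A, Finset.sum_const, smul_eq_zero] at h
    exact h.resolve_left (Finset.card_ne_zero_of_mem (Finset.mem_univ A))

end WVector

/-! ### Uniqueness of the sign-symmetric weighting -/

section Uniqueness

variable {V : Type*} [Fintype V] [DecidableEq V] {k : ℕ} {ι : Type*} [Fintype ι]

theorem permute_swap_apply_of_exchange {a b : V} {A A' : Set.powersetCard V k} (ha : a ∈ A.1)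
    (hb : b ∉ A.1) (hA' : A'.1 = insert b (A.1.erase a)) (w : Weighting V k) :
    permute (Equiv.swap a b) w A = w A' := by
  rw [permute_apply]
  refine congrArg w (Subtype.ext ?_)
  ext v
  rw [mem_map_inv_iff, hA', Finset.mem_insert, Finset.mem_erase]
  by_cases hva : v = a
  · subst hva
    have : v ≠ b := fun e => hb (e ▸ ha)
    simp [hb, this]
  by_cases hvb : v = b
  · subst hvb
    simp [ha]
  rw [Equiv.swap_apply_of_ne_of_ne hva hvb]
  simp [hva, hvb]

theorem permute_swap_apply_of_mem_iff {a b : V} {A : Set.powersetCard V k} (h : a ∈ A.1 ↔ b ∈ A.1)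
    (w : Weighting V k) : permute (Equiv.swap a b) w A = w A := by
  rw [permute_apply]
  refine congrArg w (Subtype.ext ?_)
  ext v
  rw [mem_map_inv_iff]
  by_cases hva : v = a
  · subst hva
    simp [h]
  by_cases hvb : v = b
  · subst hvb
    simp [h]
  rw [Equiv.swap_apply_of_ne_of_ne hva hvb]

/-- A weighting with the symmetries of `pairWeighting k x y` is proportional to it. -/
theorem mul_pairWeighting_comm {x y : ι → V} (h : Function.Injective (Sum.elim x y))
    {v : Weighting V k} (hpair : ∀ l, permute (Equiv.swap (x l) (y l)) v = -v)
    (hfix : ∀ a b, (∀ l, x l ≠ a) → (∀ l, y l ≠ a) → (∀ l, x l ≠ b) → (∀ l, y l ≠ b) →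
      permute (Equiv.swap a b) v = v) (A B : Set.powersetCard V k) :
    v A * pairWeighting k x y B = v B * pairWeighting k x y A := by
  have hzero : ∀ (l : ι) (C : Set.powersetCard V k), (x l ∈ C.1 ↔ y l ∈ C.1) →
      v C = 0 ∧ pairWeighting k x y C = 0 := by
    intro l C hC
    refine ⟨?_, signProd_eq_zero l hC⟩
    have h1 := permute_swap_apply_of_mem_iff hC v
    rw [hpair l, PiLp.neg_apply] at h1
    linarith
  refine mul_comm_of_exchange v (pairWeighting k x y) (fun A B hAB => ?_) A B
  by_cases hA : ∃ l, x l ∈ A.1 ↔ y l ∈ A.1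
  · obtain ⟨l, hl⟩ := hA
    left
    rw [(hzero l A hl).1, (hzero l A hl).2, zero_mul, mul_zero]
  by_cases hB : ∃ l, x l ∈ B.1 ↔ y l ∈ B.1
  · obtain ⟨l, hl⟩ := hB
    left
    rw [(hzero l B hl).1, (hzero l B hl).2, zero_mul, mul_zero]
  right
  push Not at hA hB
  obtain ⟨a, ha⟩ := exists_mem_sdiff_of_ne hAB
  obtain ⟨b, hb⟩ := exists_mem_sdiff_of_ne hAB.symm
  -- Both edges now meet every pair exactly once. If `a` or `b` lies in a pair, `A` and `B` pick
  -- opposite ends of it, and exchanging these costs a factor -1; otherwise the swap of `a` and `b`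
  -- fixes both weightings.
  by_cases hl : ∃ l, x l = a ∨ y l = a ∨ x l = b ∨ y l = b
  · obtain ⟨l, hl⟩ := hl
    have hcases : (x l ∈ A.1 \ B.1 ∧ y l ∈ B.1 \ A.1) ∨ (y l ∈ A.1 \ B.1 ∧ x l ∈ B.1 \ A.1) := by
      have h1 := hA l
      have h2 := hB l
      simp only [Finset.mem_sdiff] at ha hb ⊢
      rcases hl with rfl | rfl | rfl | rfl <;> tauto
    rcases hcases with ⟨h1, h2⟩ | ⟨h1, h2⟩
    · refine ⟨x l, h1, y l, h2, -1, by norm_num, fun A' hA' => ?_⟩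
      rw [Finset.mem_sdiff] at h1 h2
      rw [← permute_swap_apply_of_exchange h1.1 h2.2 hA',
        ← permute_swap_apply_of_exchange h1.1 h2.2 hA', hpair, permute_swap_pair h]
      simp
    · refine ⟨y l, h1, x l, h2, -1, by norm_num, fun A' hA' => ?_⟩
      rw [Finset.mem_sdiff] at h1 h2
      rw [← permute_swap_apply_of_exchange h1.1 h2.2 hA',
        ← permute_swap_apply_of_exchange h1.1 h2.2 hA', Equiv.swap_comm, hpair,
        permute_swap_pair h]
      simp
  · push Not at hl
    refine ⟨a, ha, b, hb, 1, one_ne_zero, fun A' hA' => ?_⟩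
    rw [Finset.mem_sdiff] at ha hb
    rw [← permute_swap_apply_of_exchange ha.1 hb.2 hA',
      ← permute_swap_apply_of_exchange ha.1 hb.2 hA',
      hfix a b (fun l => (hl l).1) (fun l => (hl l).2.1) (fun l => (hl l).2.2.1)
        (fun l => (hl l).2.2.2),
      permute_swap_of_notMem (fun l => (hl l).1) (fun l => (hl l).2.1) (fun l => (hl l).2.2.1)
        (fun l => (hl l).2.2.2)]
    simp

/-- Permutations act by isometries preserving `M`, so the image of the projection has the defining
property of the projection of the image. -/
theorem permute_starProjection {V : Type*} [Fintype V] {k : ℕ} {M : Submodule ℝ (Weighting V k)}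
    (hM : ∀ (π : Equiv.Perm V), ∀ m ∈ M, permute π m ∈ M) (π : Equiv.Perm V) (w : Weighting V k) :
    permute π (M.starProjection w) = M.starProjection (permute π w) := by
  symm
  refine Submodule.eq_starProjection_of_mem_of_inner_eq_zero
    (hM π _ (M.starProjection_apply_mem w)) fun m hm => ?_
  rw [← permute_sub, inner_permute_left]
  exact M.starProjection_inner_eq_zero w _ (hM _ m hm)

/-- A permutation-invariant subspace contains `pairWeighting k x y` unless it is orthogonal to it. -/
theorem pairWeighting_mem_of_inner_ne_zero {M : Submodule ℝ (Weighting V k)}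
    (hM : ∀ (π : Equiv.Perm V), ∀ m ∈ M, permute π m ∈ M) {x y : ι → V}
    (h : Function.Injective (Sum.elim x y)) {w : Weighting V k} (hw : w ∈ M)
    (hne : inner ℝ (pairWeighting k x y) w ≠ 0) : pairWeighting k x y ∈ M := by
  set v := M.starProjection (pairWeighting k x y) with hv
  have hvw : inner ℝ v w = inner ℝ (pairWeighting k x y) w := by
    have := M.starProjection_inner_eq_zero (pairWeighting k x y) w hw
    rw [inner_sub_left] at this
    linarith
  have hprop := mul_pairWeighting_comm h (v := v)
    (fun l => by rw [hv, permute_starProjection hM, permute_swap_pair h, map_neg])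
    (fun a b h1 h2 h3 h4 => by
      rw [hv, permute_starProjection hM, permute_swap_of_notMem h1 h2 h3 h4])
  obtain ⟨B, hB⟩ : ∃ B, pairWeighting k x y B ≠ 0 := by
    by_contra! hc
    exact hne (by simp [inner_eq_sum, hc])
  have hsmul : v = (v B / pairWeighting k x y B) • pairWeighting k x y := by
    ext A
    rw [PiLp.smul_apply, smul_eq_mul, div_mul_eq_mul_div, eq_div_iff hB]
    exact hprop A B
  -- The projection has the same nonzero inner product with `w ∈ M` as the product itself, so it
  -- cannot vanish.
  have hc : v B / pairWeighting k x y B ≠ 0 := by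
    intro hc
    rw [hc, zero_smul] at hsmul
    rw [← hvw, hsmul, inner_zero_left] at hne
    exact hne rfl
  have hmem : v ∈ M := M.starProjection_apply_mem _
  rw [hsmul] at hmem
  exact (M.smul_mem_iff hc).1 hmem

end Uniqueness

/-! ### Discrepancy and the orthogonal decomposition -/

section Disc

variable {V : Type*} [Fintype V] [DecidableEq V] {k : ℕ}

theorem disc_eq_zero_iff (w u : Weighting V k) :
    disc w u = 0 ↔ ∀ π : Equiv.Perm V,
      inner ℝ (permute π w) u = density w * density u * ((Fintype.card V).choose k : ℝ) := by
  rw [disc]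
  constructor
  · intro h π
    have h1 := Finset.le_sup' (fun π : Equiv.Perm V => |inner ℝ (permute π w) u -
      density w * density u * ((Fintype.card V).choose k : ℝ)|) (Finset.mem_univ π)
    rw [h] at h1
    exact sub_eq_zero.1 (abs_nonpos_iff.1 h1)
  · intro h
    refine le_antisymm (Finset.sup'_le _ _ fun π _ => ?_) ?_
    · rw [h π, sub_self, abs_zero]
    · exact (abs_nonneg _).trans (Finset.le_sup' (fun π : Equiv.Perm V => |inner ℝ (permute π w) u -
        density w * density u * ((Fintype.card V).choose k : ℝ)|) (Finset.mem_univ 1))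

variable {x y : Fin k → V}

theorem permute_mem_canonicalSpan {i : Fin (k + 1)} {w : Weighting V k}
    (hw : w ∈ canonicalSpan x y i) (π : Equiv.Perm V) : permute π w ∈ canonicalSpan x y i := by
  induction hw using Submodule.span_induction with
  | mem w hw =>
    obtain ⟨σ, rfl⟩ := hw
    simp only
    rw [← permute_mul]
    exact Submodule.subset_span ⟨π * σ, rfl⟩
  | zero => exact Submodule.zero_mem _
  | add u v _ _ hu hv => exact Submodule.add_mem _ hu hv
  | smul c u _ hu => exact Submodule.smul_mem _ c hu

theorem canonicalSpan_le_orthogonal_of_lt (h : Function.Injective (Sum.elim x y))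
    {i j : Fin (k + 1)} (hij : i < j) : canonicalSpan x y i ≤ (canonicalSpan x y j)ᗮ := by
  refine Submodule.span_le.2 ?_
  rintro _ ⟨π, rfl⟩
  simp only
  rw [phi_eq_pairWeighting h, permute_pairWeighting]
  refine (mem_canonicalSpan_orthogonal_iff h j _).2 fun x' y' h' => ?_
  rw [real_inner_comm]
  exact inner_pairWeighting_eq_zero _ _ h' (by simpa using hij)

theorem canonicalSpan_isOrtho (h : Function.Injective (Sum.elim x y)) {i j : Fin (k + 1)}
    (hij : i ≠ j) : canonicalSpan x y i ⟂ canonicalSpan x y j := by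
  rcases lt_or_gt_of_ne hij with hlt | hlt
  · exact canonicalSpan_le_orthogonal_of_lt h hlt
  · exact Submodule.IsOrtho.symm (canonicalSpan_le_orthogonal_of_lt h hlt)

theorem mem_orthogonal_iff_wVector {V : Type*} [Fintype V] [DecidableEq V] {k : ℕ}
    {x y : Fin k → V} (h : Function.Injective (Sum.elim x y)) (i : Fin (k + 1))
    (w : Weighting V k) : w ∈ (canonicalSpan x y i)ᗮ ↔ wVector (i : ℕ) w = 0 :=
  (mem_canonicalSpan_orthogonal_iff h i w).trans (wVector_eq_zero_iff i w).symm

/-- Orthogonality to `V_0` is exactly the vanishing of `W_0`, the absolute value of the density. -/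
theorem density_eq_zero_of_mem (h : Function.Injective (Sum.elim x y)) {i : Fin (k + 1)}
    (hi : i ≠ 0) {w : Weighting V k} (hw : w ∈ canonicalSpan x y i) : density w = 0 := by
  have := (mem_orthogonal_iff_wVector h 0 w).1 (canonicalSpan_isOrtho h hi hw)
  rwa [Fin.val_zero, wVector, abs_eq_zero] at this

theorem phi_mem_canonicalSpan (i : Fin (k + 1)) : phi x y i ∈ canonicalSpan x y i :=
  Submodule.subset_span ⟨1, permute_one _⟩

theorem disc_phi_eq_zero_iff (h : Function.Injective (Sum.elim x y)) {i : Fin (k + 1)}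
    (hi : i ≠ 0) (w : Weighting V k) :
    disc w (phi x y i) = 0 ↔ w ∈ (canonicalSpan x y i)ᗮ := by
  rw [disc_eq_zero_iff, density_eq_zero_of_mem h hi (phi_mem_canonicalSpan i), mul_zero, zero_mul]
  constructor
  · intro hw
    rw [canonicalSpan, Submodule.mem_orthogonal]
    intro u hu
    induction hu using Submodule.span_induction with
    | mem u hu =>
      obtain ⟨π, rfl⟩ := hu
      simp only
      rw [inner_permute_left, real_inner_comm]
      exact hw _
    | zero => exact inner_zero_left _
    | add u v _ _ hu hv => rw [inner_add_left, hu, hv, add_zero]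
    | smul c u _ hu => rw [inner_smul_left, hu, mul_zero]
  · intro hw π
    rw [inner_permute_left, real_inner_comm]
    exact (Submodule.mem_orthogonal _ _).1 hw _
      (permute_mem_canonicalSpan (phi_mem_canonicalSpan i) _)

theorem disc_eq_zero_of_mem (h : Function.Injective (Sum.elim x y)) {i j : Fin (k + 1)}
    (hij : i ≠ j) {u w : Weighting V k} (hu : u ∈ canonicalSpan x y i)
    (hw : w ∈ canonicalSpan x y j) : disc u w = 0 := by
  have hd : density u * density w = 0 := by
    by_cases hi : i = 0
    · rw [density_eq_zero_of_mem h (fun hj => hij (hi.trans hj.symm)) hw, mul_zero]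
    · rw [density_eq_zero_of_mem h hi hu, zero_mul]
  rw [disc_eq_zero_iff, hd, zero_mul]
  intro π
  exact (canonicalSpan_isOrtho h hij).inner_eq (permute_mem_canonicalSpan hu π) hw

theorem isInternal_canonicalSpan (hn : 2 * k ≤ Fintype.card V)
    (h : Function.Injective (Sum.elim x y)) : DirectSum.IsInternal (canonicalSpan x y) := by
  refine (OrthogonalFamily.isInternal_iff ?_).2 ?_
  · exact OrthogonalFamily.of_pairwise fun i j hij => canonicalSpan_isOrtho h hij
  · rw [eq_bot_iff, ← Submodule.iInf_orthogonal]
    intro w hw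
    rw [Submodule.mem_iInf] at hw
    refine (Submodule.mem_bot ℝ).2 (eq_zero_of_wVector_eq_zero k hn w fun i hi => ?_)
    exact (mem_orthogonal_iff_wVector h ⟨i, Nat.lt_succ_of_le hi⟩ w).1 (hw _)

theorem sum_mem_orthogonal_iff (h : Function.Injective (Sum.elim x y))
    {c : Fin (k + 1) → Weighting V k} (hc : ∀ i, c i ∈ canonicalSpan x y i) (i : Fin (k + 1)) :
    ∑ j, c j ∈ (canonicalSpan x y i)ᗮ ↔ c i = 0 := by
  have hrest : ∑ j ∈ univ.erase i, c j ∈ (canonicalSpan x y i)ᗮ :=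
    Submodule.sum_mem _ fun j hj =>
      canonicalSpan_isOrtho h (Finset.ne_of_mem_erase hj) (hc j)
  rw [← Finset.add_sum_erase _ _ (Finset.mem_univ i), Submodule.add_mem_iff_left _ hrest]
  constructor
  · intro hi
    exact inner_self_eq_zero.1 ((Submodule.mem_orthogonal _ _).1 hi _ (hc i))
  · intro hi
    rw [hi]
    exact Submodule.zero_mem _

/-- The constant weighting with value `1`. -/
def oneWeighting (V : Type*) [Fintype V] (k : ℕ) : Weighting V k := WithLp.toLp 2 fun _ => 1

/-- Centring `w` turns the discrepancy terms into plain inner products, so zero discrepancy becomes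
orthogonality to an orbit. -/
theorem inner_sub_density_smul {V : Type*} [Fintype V] {k : ℕ} (w u : Weighting V k)
    (π : Equiv.Perm V) :
    inner ℝ (permute π (w - density w • oneWeighting V k)) u =
      inner ℝ (permute π w) u - density w * density u * ((Fintype.card V).choose k : ℝ) := by
  have h1 : permute π (w - density w • oneWeighting V k) =
      permute π w - density w • oneWeighting V k := rfl
  have h2 : inner ℝ (oneWeighting V k) u = density u * ((Fintype.card V).choose k : ℝ) := by
    have h3 : inner ℝ (oneWeighting V k) u = ∑ A, u A := by
      simp [inner_eq_sum, oneWeighting]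
    rw [h3]
    by_cases hz : ((Fintype.card V).choose k : ℝ) = 0
    · have : density u = 0 := by rw [density, hz, div_zero]
      rw [(density_eq_zero_iff u).1 this, hz, mul_zero]
    · rw [density, div_mul_cancel₀ _ hz]
  rw [h1, inner_sub_left, real_inner_smul_left, h2, mul_assoc]

/-- Two weightings with discrepancy zero have no common component outside the constants. -/
theorem mem_orthogonal_or_of_disc_eq_zero (h : Function.Injective (Sum.elim x y))
    {w u : Weighting V k} (hd : disc w u = 0) {i : Fin (k + 1)} (hi : i ≠ 0) :
    w ∈ (canonicalSpan x y i)ᗮ ∨ u ∈ (canonicalSpan x y i)ᗮ := by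
  rw [or_iff_not_imp_left]
  intro hw
  rw [mem_canonicalSpan_orthogonal_iff h] at hw
  push Not at hw
  obtain ⟨x', y', h', hne⟩ := hw
  set w' := w - density w • oneWeighting V k with hw'
  let M := Submodule.span ℝ (Set.range fun π : Equiv.Perm V => permute π w')
  have hM : ∀ (π : Equiv.Perm V), ∀ m ∈ M, permute π m ∈ M := by
    intro π m hm
    induction hm using Submodule.span_induction with
    | mem w hw =>
      obtain ⟨σ, rfl⟩ := hw
      simp only
      rw [← permute_mul]
      exact Submodule.subset_span ⟨π * σ, rfl⟩
    | zero => exact Submodule.zero_mem _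
    | add u v _ _ hu hv => exact Submodule.add_mem _ hu hv
    | smul c u _ hu => exact Submodule.smul_mem _ c hu
  -- The constant 1 is the empty product, shorter than any product with `i ≥ 1` factors; centring
  -- therefore does not affect the inner product with it.
  have hone : inner ℝ (pairWeighting k x' y') (oneWeighting V k) = 0 := by
    have he : oneWeighting V k = pairWeighting k (Fin.elim0 : Fin 0 → V) Fin.elim0 := by
      ext A
      simp [oneWeighting, pairWeighting_apply, signProd]
    rw [he, real_inner_comm]
    refine inner_pairWeighting_eq_zero _ _ h' ?_
    simpa using Nat.pos_of_ne_zero fun h0 => hi (Fin.ext h0)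
  have hw'M : w' ∈ M := Submodule.subset_span ⟨1, permute_one _⟩
  have hne' : inner ℝ (pairWeighting k x' y') w' ≠ 0 := by
    rwa [hw', inner_sub_right, real_inner_smul_right, hone, mul_zero, sub_zero]
  have hmem := pairWeighting_mem_of_inner_ne_zero hM h' hw'M hne'
  have hMu : ∀ m ∈ M, inner ℝ m u = 0 := by
    intro m hm
    induction hm using Submodule.span_induction with
    | mem m hm =>
      obtain ⟨π, rfl⟩ := hm
      simp only
      rw [hw', inner_sub_density_smul, (disc_eq_zero_iff w u).1 hd π, sub_self]
    | zero => exact inner_zero_left _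
    | add u v _ _ hu hv => rw [inner_add_left, hu, hv, add_zero]
    | smul c u _ hu => rw [inner_smul_left, hu, mul_zero]
  rw [mem_canonicalSpan_orthogonal_iff h]
  intro x'' y'' h''
  obtain ⟨π, rfl, rfl⟩ := exists_perm_comp_eq h' h''
  rw [← permute_pairWeighting]
  exact hMu _ (hM π _ hmem)

theorem exists_sum_eq (hn : 2 * k ≤ Fintype.card V) (h : Function.Injective (Sum.elim x y))
    (w : Weighting V k) :
    ∃ c : Fin (k + 1) → Weighting V k, (∀ i, c i ∈ canonicalSpan x y i) ∧ w = ∑ i, c i := by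
  have htop := (isInternal_canonicalSpan hn h).submodule_iSup_eq_top
  obtain ⟨c, hc⟩ := (Submodule.mem_iSup_iff_exists_finsupp _ w).1 (htop ▸ Submodule.mem_top)
  refine ⟨c, hc.1, ?_⟩
  rw [← hc.2, Finsupp.sum_fintype _ _ fun _ => rfl]

theorem exists_disjoint_supports (hn : 2 * k ≤ Fintype.card V)
    (h : Function.Injective (Sum.elim x y)) {t : ℕ} (w : Fin t → Weighting V k) (ht : 1 ≤ t)
    (hd : ∀ i j, i ≠ j → disc (w i) (w j) = 0) :
    ∃ I : Fin t → Set (Fin (k + 1)),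
      Pairwise (Function.onFun Disjoint I) ∧ (⋃ i, I i) = {h | h ≠ 0} ∧
      ∀ i, w i ∈ canonicalSpan x y 0 ⊔ ⨆ h ∈ I i, canonicalSpan x y h := by
  -- Each `w i` receives the nonzero indices where it has a component; indices used by no weighting
  -- go to the first one, so that the union is everything.
  refine ⟨fun i => {j | j ≠ 0 ∧ (w i ∉ (canonicalSpan x y j)ᗮ ∨
    (i = ⟨0, ht⟩ ∧ ∀ i', w i' ∈ (canonicalSpan x y j)ᗮ))}, ?_, ?_, ?_⟩
  · intro i i' hii'
    refine Set.disjoint_left.2 ?_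
    rintro j ⟨hj, hi⟩ ⟨-, hi'⟩
    have := mem_orthogonal_or_of_disc_eq_zero h (hd i i' hii') hj
    rcases hi with hi | ⟨hi, hall⟩ <;> rcases hi' with hi' | ⟨hi', hall'⟩
    · exact this.elim hi hi'
    · exact hi (hall' i)
    · exact hi' (hall i')
    · exact hii' (hi.trans hi'.symm)
  · ext j
    simp only [Set.mem_iUnion, Set.mem_ofPred_eq]
    constructor
    · rintro ⟨i, hj, -⟩
      exact hj
    · intro hj
      by_cases hall : ∀ i', w i' ∈ (canonicalSpan x y j)ᗮ
      · exact ⟨⟨0, ht⟩, hj, Or.inr ⟨rfl, hall⟩⟩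
      · push Not at hall
        obtain ⟨i, hi⟩ := hall
        exact ⟨i, hj, Or.inl hi⟩
  · intro i
    obtain ⟨c, hc, hw⟩ := exists_sum_eq hn h (w i)
    rw [hw]
    refine Submodule.sum_mem _ fun j _ => ?_
    by_cases hj : j = 0
    · subst hj
      exact Submodule.mem_sup_left (hc 0)
    by_cases hcj : c j = 0
    · rw [hcj]
      exact Submodule.zero_mem _
    refine Submodule.mem_sup_right (Submodule.mem_iSup_of_mem j (Submodule.mem_iSup_of_mem ?_ (hc j)))
    exact ⟨hj, Or.inl fun hm => hcj ((sum_mem_orthogonal_iff h hc j).1 (hw ▸ hm))⟩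

end Disc

end

end WHyp

theorem theorem5 {V : Type*} [Fintype V] [DecidableEq V] (k : ℕ) (hk : 1 ≤ k)
    (hn : 2 * k ≤ Fintype.card V) (x y : Fin k → V)
    (hxy : Function.Injective (Sum.elim x y)) :
    -- (a)
    (∀ (i : Fin (k + 1)) (w : WHyp.Weighting V k), i ≠ 0 →
      (WHyp.disc w (WHyp.phi x y i) = 0 ↔ w ∈ (WHyp.canonicalSpan x y i)ᗮ)) ∧
    -- (b)
    (∀ (i j : Fin (k + 1)) (u w : WHyp.Weighting V k), i ≠ j →
      u ∈ WHyp.canonicalSpan x y i → w ∈ WHyp.canonicalSpan x y j → WHyp.disc u w = 0) ∧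
    -- (c)
    DirectSum.IsInternal (WHyp.canonicalSpan x y) ∧
    -- (d)
    (∀ (u : WHyp.Weighting V k) (c : Fin (k + 1) → WHyp.Weighting V k),
      (∀ i, c i ∈ WHyp.canonicalSpan x y i) → u = ∑ i, c i →
      ∀ i : Fin (k + 1), WHyp.wVector (i : ℕ) u = 0 ↔ c i = 0) ∧
    -- (e)
    (∀ (t : ℕ) (w : Fin t → WHyp.Weighting V k), 1 ≤ t → (∀ i, w i ≠ 0) →
      (∀ i j, i ≠ j → WHyp.disc (w i) (w j) = 0) →
      ∃ I : Fin t → Set (Fin (k + 1)),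
        Pairwise (Function.onFun Disjoint I) ∧ (⋃ i, I i) = {h | h ≠ 0} ∧
        ∀ i, w i ∈ WHyp.canonicalSpan x y 0 ⊔ ⨆ h ∈ I i, WHyp.canonicalSpan x y h) := by
  refine ⟨fun i w hi => WHyp.disc_phi_eq_zero_iff hxy hi w,
    fun i j u w hij hu hw => WHyp.disc_eq_zero_of_mem hxy hij hu hw,
    WHyp.isInternal_canonicalSpan hn hxy, ?_,
    fun t w ht _ hd => WHyp.exists_disjoint_supports hn hxy w ht hd⟩
  intro u c hc hu i
  rw [← WHyp.mem_orthogonal_iff_wVector hxy, hu]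
  exact WHyp.sum_mem_orthogonal_iff hxy hc i
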